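/- Let $\Gamma=\{0,1,A\}$ be an alphabet with three letters and let $\Gamma^\omega$ be the set of infinite words over $\Gamma$, with the product of the discrete topologies; let $\alpha\in\Gamma^\omega$ be the infinite word $$\alpha=A.0.A.0^2.A.0^3.A.0^4.A\cdots A.0^n.A.0^{n+1}.A\cdots .$$ A 2-tape Büchi automaton over $\Gamma,\Gamma$ consists of a finite set $K$ of states, a finite set $\Delta\subseteq K\times\Gamma^*\times\Gamma^*\times K$ of transitions, an initial state $q_0\in K$ and a set $F\subseteq K$ of accepting states. It accepts $(u,v)\in\Gamma^\omega\times\Gamma^\omega$ if there is an infinite sequence of transitions $(q_{i-1},u_i,v_i,q_i)\in\Delta$, $i\ge 1$, starting in the initial state $q_0$, such that $u=u_1.u_2.u_3\cdots$, $v=v_1.v_2.v_3\cdots$, and $q_i=q_f$ for infinitely many $i$, for some $q_f\in F$. A relation $R\subseteq\Gamma^\omega\times\Gamma^\omega$ is an infinitary rational relation if it is the set of all pairs accepted by some 2-tape Büchi automaton. In a topological space, $\mathbf\Sigma^0_1$ and $\mathbf\Pi^0_1$ are the classes of open and of closed sets and, for $n\ge1$, $\mathbf\Sigma^0_{n+1}$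 (respectively $\mathbf\Pi^0_{n+1}$) is the class of countable unions of $\mathbf\Pi^0_n$ sets (respectively countable intersections of $\mathbf\Sigma^0_n$ sets). A subset $F$ of $X=\Gamma^\omega$ or $X=\Gamma^\omega\times\Gamma^\omega$ (with the product topology) is $\mathbf\Pi^0_n$-complete if it is $\mathbf\Pi^0_n$ and, for every finite alphabet $Y$ and every $E\subseteq Y^\omega$, $E$ is $\mathbf\Pi^0_n$ if and only if $E=f^{-1}(F)$ for some continuous $f:Y^\omega\to X$. **Theorem.** There exists an infinitary rational relation $R\subseteq\Gamma^\omega\times\Gamma^\omega$ such that 1. $R_\alpha=\{\sigma\in\Gamma^\omega\mid(\sigma,\alpha)\in R\}$ is a $\mathbf\Pi^0_3$-complete subset of $\Gamma^\omega$; 2. for every $u\in\Gamma^\omega$ with $u\ne\alpha$, $R_u=\{\sigma\in\Gamma^\omega\mid(\sigma,u)\in R\}=\Gamma^\omega$; 3. $R$ is a $\mathbf\Pi^0_3$-complete subset of $\Gamma^\omega\times\Gamma^\omega$. -/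

import Mathlib

open Set Filter Topology

/-- Infinite words (`ω`-words) over `X`, indexed from `0`. For a discrete finite alphabet `X`
the product topology of `ℕ → X` is the Cantor topology. -/
abbrev OmegaWord (X : Type) : Type := ℕ → X

/-- The finite word `w 0 ++ w 1 ++ ⋯ ++ w (n - 1)`. -/
def concatPrefix {X : Type} (w : ℕ → List X) : ℕ → List X
  | 0 => []
  | n + 1 => concatPrefix w n ++ w n

/-- `u = w 0 . w 1 . w 2 . ⋯`: every finite concatenation is a prefix of `u`, and these
prefixes exhaust `u`. -/
def IsOmegaConcat {X : Type} (w : ℕ → List X) (u : OmegaWord X) : Prop :=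
  (∀ n i, ∀ h : i < (concatPrefix w n).length, (concatPrefix w n)[i] = u i) ∧
    ∀ N, ∃ n, N ≤ (concatPrefix w n).length

/-- A 2-tape Büchi automaton over the alphabets `X` and `Y`. -/
structure TwoTapeBuchi (X Y : Type) where
  /-- states -/
  K : Type
  finite_K : Finite K
  /-- transitions -/
  Δ : Set (K × List X × List Y × K)
  finite_Δ : Δ.Finite
  /-- initial state -/
  q₀ : K
  /-- accepting states -/
  F : Set K

namespace TwoTapeBuchi

/-- `(q i, a i, b i, q (i + 1))`, `i = 0, 1, …`, is a computation of `T` over `(u, v)`. -/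
def IsComputation {X Y : Type} (T : TwoTapeBuchi X Y) (q : ℕ → T.K) (a : ℕ → List X)
    (b : ℕ → List Y) (u : OmegaWord X) (v : OmegaWord Y) : Prop :=
  q 0 = T.q₀ ∧ (∀ i, (q i, a i, b i, q (i + 1)) ∈ T.Δ) ∧ IsOmegaConcat a u ∧ IsOmegaConcat b v

/-- The set of pairs over which `T` has a successful computation, i.e. one in which some
accepting state occurs infinitely often. -/
def relation {X Y : Type} (T : TwoTapeBuchi X Y) : Set (OmegaWord X × OmegaWord Y) :=
  {p | ∃ q a b, T.IsComputation q a b p.1 p.2 ∧ ∃ qf ∈ T.F, {i | q i = qf}.Infinite}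

end TwoTapeBuchi

/-- Infinitary rational relations: those accepted by a 2-tape Büchi automaton. -/
def IsInfinitaryRational {X Y : Type} [Finite X] [Finite Y]
    (R : Set (OmegaWord X × OmegaWord Y)) : Prop :=
  ∃ T : TwoTapeBuchi X Y, T.relation = R

/-- The pair `(Σ⁰ₙ, Π⁰ₙ)` of classes of subsets of `X`, for `n ≥ 1` (both empty for `n = 0`). -/
def borelClasses (X : Type) [TopologicalSpace X] : ℕ → Set (Set X) × Set (Set X)
  | 0 => (∅, ∅)
  | 1 => ({s | IsOpen s}, {s | IsClosed s})
  | n + 2 =>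
    ({s | ∃ f : ℕ → Set X, (∀ i, f i ∈ (borelClasses X (n + 1)).2) ∧ s = ⋃ i, f i},
     {s | ∃ f : ℕ → Set X, (∀ i, f i ∈ (borelClasses X (n + 1)).1) ∧ s = ⋂ i, f i})

/-- `s` is a `Π⁰ₙ` subset of `X`. -/
def IsPi0 {X : Type} [TopologicalSpace X] (n : ℕ) (s : Set X) : Prop := s ∈ (borelClasses X n).2

/-- `F` is a `Π⁰ₙ`-complete subset of `X`: it is `Π⁰ₙ`, and the `Π⁰ₙ` sets of infinite words over
finite alphabets are exactly the preimages of `F` under continuous maps. -/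
def IsPi0Complete {X : Type} [TopologicalSpace X] (n : ℕ) (F : Set X) : Prop :=
  IsPi0 n F ∧
    ∀ (Y : Type) [Finite Y] [TopologicalSpace Y] [DiscreteTopology Y] (E : Set (OmegaWord Y)),
      IsPi0 n E ↔ ∃ f : OmegaWord Y → X, Continuous f ∧ E = f ⁻¹' F

/-- The alphabet `Γ = {0, 1, A}`. -/
inductive Letter : Type
  | zero
  | one
  | A

instance : Finite Letter :=
  Finite.of_surjective (fun i : Fin 3 => if i = 0 then Letter.zero else if i = 1 then Letter.one
    else Letter.A) (fun x => by
      cases x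
      · exact ⟨0, by simp⟩
      · exact ⟨1, by simp⟩
      · exact ⟨2, by simp⟩)

instance : TopologicalSpace Letter := ⊥

instance : DiscreteTopology Letter := ⟨rfl⟩

/-- The blocks `A.0`, `A.0²`, `A.0³`, … -/
def alphaBlock (n : ℕ) : List Letter := Letter.A :: List.replicate (n + 1) Letter.zero

/-- The infinite word `α = A.0.A.0².A.0³.A ⋯`. Its letter number `k` is read off the
concatenation of the first `k + 1` blocks, which has more than `k` letters. -/
def alpha : OmegaWord Letter := fun k => (concatPrefix alphaBlock (k + 1)).getD k Letter.zero

theorem le_length_concatPrefix_alphaBlock (n : ℕ) :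
    n ≤ (concatPrefix alphaBlock n).length := by
  induction n with
  | zero => simp
  | succ n ih => simp [concatPrefix, alphaBlock]; omega

theorem concatPrefix_prefix {X : Type} (w : ℕ → List X) {m n : ℕ} (h : m ≤ n) :
    concatPrefix w m <+: concatPrefix w n := by
  induction n, h using Nat.le_induction with
  | base => exact List.prefix_rfl
  | succ n _ ih => exact ih.trans (List.prefix_append _ _)

/-- `alpha` is indeed the infinite concatenation of the blocks `A.0ⁿ⁺¹`. -/
theorem isOmegaConcat_alpha : IsOmegaConcat alphaBlock alpha := by
  refine ⟨fun n i h => ?_, fun N => ⟨N, le_length_concatPrefix_alphaBlock N⟩⟩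
  have h' : i < (concatPrefix alphaBlock (i + 1)).length :=
    le_length_concatPrefix_alphaBlock (i + 1)
  have e : alpha i = (concatPrefix alphaBlock (i + 1))[i] := by
    simp only [alpha, List.getD_eq_getElem _ _ h']
  rw [e]
  rcases le_total n (i + 1) with hn | hn
  · exact (concatPrefix_prefix alphaBlock hn).getElem h
  · exact ((concatPrefix_prefix alphaBlock hn).getElem h').symm

/-!
The relation `fadingRelation` consists of the pairs `(σ, u)` such that `u ≠ alpha`, or `σ` does not
have its letters `A` exactly where `alpha` has them, or `σ` is *fading*: cut `σ` at its letters `A`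
into rows `x₀, x₁, x₂, …` over `{0, 1}`, with `|xₖ| = k + 1`; then every column of this triangular
array contains finitely many `1`s.

*The relation is rational.* Let `erase` send `1` to `0`, and let `stretch` be the substitution
`A ↦ A0`, `0 ↦ 0`, `1 ↦ 0`. The word `alpha` is the only solution of `u = A0.stretch(u)`
(`isOmegaConcat_stretchBlock_self_iff`), so that both `erase(σ) = u` and `u = alpha` can be refuted
by comparing `u` letter by letter with `erase(σ)`, respectively with `A0.stretch(σ)`; an automaton
with two heads does this (`mem_relation_of_ne_erase`, `mem_relation_of_ne_alpha`). If both
equalities hold, `σ` is fading if and only if for some `d₀ ≤ d₁ ≤ ⋯` tending to infinity almost all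
rows start with at least `dₖ` zeros. The automaton guesses `dₖ` as the lag of its second head: when
the first head has passed the `A` in front of row `k` while the second one has not, the first head
must read `0`. The lag may grow by one at each letter `A` of `σ`, and it has to grow infinitely
often (`mem_relation_of_fading`, `fading_of_mem_relation`).

*The relation is `Π⁰₃`-complete, and so is its section at `alpha`.* Membership is a condition of the
form "for all `m` there is `N` such that a closed condition holds" (`isPi0_fadingRelation`).
Conversely, let `E = ⋂ m, ⋃ k, F m k` with closed `F m k`. For a fixed `m`, the least `k` such that
the prefix of length `n` of `x` can be continued to an element of `F m k` stabilizes as `n` grows if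
and only if `x ∈ ⋃ k, F m k`. Writing a `1` in row `n` and column `m` whenever that index changes
(`IsPi0.exists_clopen_matrix`, `encodeMatrix`) is a continuous map from words to words over the rows
of `alpha` under which `E` is the preimage of the fading words.
-/

/-! ### Infinite concatenations -/

/-- The factor `u p, u (p + 1), …, u (p + l - 1)` of an infinite word. -/
def slice {X : Type} (u : OmegaWord X) (p l : ℕ) : List X := List.ofFn fun j : Fin l => u (p + j)

@[simp] theorem length_slice {X : Type} (u : OmegaWord X) (p l : ℕ) :
    (slice u p l).length = l := by simp [slice]

@[simp] theorem slice_zero {X : Type} (u : OmegaWord X) (p : ℕ) : slice u p 0 = [] := by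
  simp [slice]

@[simp] theorem slice_one {X : Type} (u : OmegaWord X) (p : ℕ) : slice u p 1 = [u p] := by
  simp [slice]

theorem slice_append {X : Type} (u : OmegaWord X) (p k l : ℕ) :
    slice u p k ++ slice u (p + k) l = slice u p (k + l) := by
  simp [slice, List.ofFn_add, Nat.add_assoc]

theorem eq_slice_iff {X : Type} {u : OmegaWord X} {p : ℕ} {w : List X} :
    w = slice u p w.length ↔ ∀ j (h : j < w.length), w[j] = u (p + j) := by
  constructor
  · intro h j hj
    rw [List.getElem_of_eq h hj]
    simp [slice]
  · intro h
    refine List.ext_getElem (by simp) fun j hj _ => ?_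
    simp [slice, h j hj]

theorem IsOmegaConcat.concatPrefix_eq {X : Type} {w : ℕ → List X} {u : OmegaWord X}
    (h : IsOmegaConcat w u) (n : ℕ) :
    concatPrefix w n = slice u 0 (concatPrefix w n).length :=
  eq_slice_iff.2 fun j hj => by simpa using h.1 n j hj

theorem IsOmegaConcat.eq_slice {X : Type} {w : ℕ → List X} {u : OmegaWord X}
    (h : IsOmegaConcat w u) (n : ℕ) :
    w n = slice u (concatPrefix w n).length (w n).length := by
  have h1 := h.concatPrefix_eq (n + 1)
  have h0 := h.concatPrefix_eq n
  simp only [concatPrefix, List.length_append] at h1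
  rw [← slice_append, ← h0, Nat.zero_add] at h1
  exact List.append_cancel_left h1

/-- Cutting `u` at the positions `0 = P 0 ≤ P 1 ≤ ⋯` gives the infinite concatenation `u`. -/
theorem isOmegaConcat_slice {X : Type} (u : OmegaWord X) {P : ℕ → ℕ} (h0 : P 0 = 0)
    (hP : Monotone P) (hN : ∀ N, ∃ n, N ≤ P n) :
    IsOmegaConcat (fun n => slice u (P n) (P (n + 1) - P n)) u := by
  have key : ∀ n, concatPrefix (fun n => slice u (P n) (P (n + 1) - P n)) n
      = slice u 0 (P n) := by
    intro n
    induction n with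
    | zero => simp [concatPrefix, h0]
    | succ n ih =>
      have := slice_append u 0 (P n) (P (n + 1) - P n)
      rw [Nat.add_sub_cancel' (hP n.le_succ), Nat.zero_add] at this
      simp [concatPrefix, ih, this]
  refine ⟨fun n i h => ?_, fun N => ?_⟩
  · rw [List.getElem_of_eq (key n) h]
    simp [slice]
  · simpa [key] using hN N

theorem concatPrefix_singleton {X : Type} (u : OmegaWord X) (n : ℕ) :
    concatPrefix (fun i => [u i]) n = slice u 0 n := by
  induction n with
  | zero => simp [concatPrefix]
  | succ n ih => rw [concatPrefix, ih, ← slice_append]; simp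

theorem isOmegaConcat_singleton_iff {X : Type} {v u : OmegaWord X} :
    IsOmegaConcat (fun i => [v i]) u ↔ v = u := by
  constructor
  · intro h
    funext i
    have := h.eq_slice i
    simpa [concatPrefix_singleton] using this
  · rintro rfl
    simpa using isOmegaConcat_slice v (P := id) rfl monotone_id fun N => ⟨N, le_rfl⟩

theorem le_length_concatPrefix {X : Type} {w : ℕ → List X} (hw : ∀ n, w n ≠ []) (n : ℕ) :
    n ≤ (concatPrefix w n).length := by
  induction n with
  | zero => simp
  | succ n ih =>
    have := List.length_pos_iff.2 (hw n)
    simp only [concatPrefix, List.length_append]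
    omega

/-! ### The word `alpha` -/

/-- The position in `alpha` of the letter `A` that opens the block `A.0ᵏ⁺¹`. -/
def rowStart (k : ℕ) : ℕ := (concatPrefix alphaBlock k).length

theorem rowStart_succ (k : ℕ) : rowStart (k + 1) = rowStart k + (k + 2) := by
  simp [rowStart, concatPrefix, alphaBlock]

theorem strictMono_rowStart : StrictMono rowStart :=
  strictMono_nat_of_lt_succ fun k => by rw [rowStart_succ]; omega

theorem alpha_rowStart_add (k j : ℕ) (h : j < (alphaBlock k).length) :
    alpha (rowStart k + j) = (alphaBlock k)[j] :=
  (eq_slice_iff.1 (isOmegaConcat_alpha.eq_slice k) j h).symm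

theorem alpha_rowStart (k : ℕ) : alpha (rowStart k) = Letter.A := by
  simpa [alphaBlock] using alpha_rowStart_add k 0 (by simp [alphaBlock])

theorem alpha_rowStart_add_succ {k m : ℕ} (h : m ≤ k) :
    alpha (rowStart k + m + 1) = Letter.zero := by
  simpa [alphaBlock, Nat.add_assoc] using
    alpha_rowStart_add k (m + 1) (by simp [alphaBlock]; omega)

theorem exists_row (i : ℕ) :
    (∃ k, i = rowStart k) ∨ ∃ k m, m ≤ k ∧ i = rowStart k + m + 1 := by
  induction i with
  | zero => exact Or.inl ⟨0, rfl⟩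
  | succ i ih =>
    rcases ih with ⟨k, rfl⟩ | ⟨k, m, hm, rfl⟩
    · exact Or.inr ⟨k, 0, by omega, by omega⟩
    · rcases hm.lt_or_eq with h | rfl
      · exact Or.inr ⟨k, m + 1, h, by omega⟩
      · exact Or.inl ⟨m + 1, by rw [rowStart_succ]; omega⟩

theorem row_unique {k m k' m' : ℕ} (h : m ≤ k) (h' : m' ≤ k')
    (e : rowStart k + m + 1 = rowStart k' + m' + 1) : k = k' ∧ m = m' := by
  have aux : ∀ {a b : ℕ}, a < b → rowStart a + (a + 2) ≤ rowStart b := fun {a b} hab => by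
    rw [← rowStart_succ]; exact strictMono_rowStart.monotone hab
  rcases lt_trichotomy k k' with hk | rfl | hk
  · have := aux hk; omega
  · exact ⟨rfl, by omega⟩
  · have := aux hk; omega

theorem exists_rowStart_of_alpha {i : ℕ} (h : alpha i = Letter.A) : ∃ k, i = rowStart k := by
  rcases exists_row i with hk | ⟨k, m, hm, rfl⟩
  · exact hk
  · rw [alpha_rowStart_add_succ hm] at h
    cases h

/-- The projection of `{0, 1, A}` onto `{0, A}`. -/
def Letter.erase : Letter → Letter
  | A => A
  | _ => zero

theorem eq_A_iff_of_erase {σ : OmegaWord Letter} (h : (fun n => (σ n).erase) = alpha) (i : ℕ) :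
    σ i = Letter.A ↔ alpha i = Letter.A := by
  rw [← h]
  cases hi : σ i <;> simp [Letter.erase, hi]

theorem alpha_eq_zero {i : ℕ} (h : alpha i ≠ Letter.A) : alpha i = Letter.zero := by
  rcases exists_row i with ⟨k, rfl⟩ | ⟨k, m, hm, rfl⟩
  · exact absurd (alpha_rowStart k) h
  · exact alpha_rowStart_add_succ hm

/-- The substitution `A ↦ A0`, `0 ↦ 0`, `1 ↦ 0`, which lengthens every block of `alpha` by one. -/
def Letter.stretch : Letter → List Letter
  | A => [A, zero]
  | _ => [zero]

/-- The factors of the word `A0.stretch (σ 0).stretch (σ 1).stretch (σ 2) ⋯`, the prefix `A0` being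
put together with the first image. -/
def stretchBlock (σ : OmegaWord Letter) : ℕ → List Letter
  | 0 => Letter.A :: Letter.zero :: (σ 0).stretch
  | n + 1 => (σ (n + 1)).stretch

theorem Letter.stretch_erase (x : Letter) : x.erase.stretch = x.stretch := by
  cases x <;> rfl

theorem stretchBlock_erase (σ : OmegaWord Letter) :
    stretchBlock (fun n => (σ n).erase) = stretchBlock σ := by
  funext n
  cases n <;> simp [stretchBlock, Letter.stretch_erase]

theorem stretchBlock_ne_nil (σ : OmegaWord Letter) (n : ℕ) : stretchBlock σ n ≠ [] := by
  cases n with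
  | zero => simp [stretchBlock]
  | succ n => cases h : σ (n + 1) <;> simp [stretchBlock, Letter.stretch, h]

theorem concatPrefix_stretchBlock (σ : OmegaWord Letter) (n : ℕ) :
    concatPrefix (stretchBlock σ) (n + 1)
      = Letter.A :: Letter.zero :: (slice σ 0 (n + 1)).flatMap Letter.stretch := by
  induction n with
  | zero => simp [concatPrefix, stretchBlock]
  | succ n ih =>
    rw [concatPrefix, ih, ← slice_append σ 0 (n + 1) 1]
    simp [stretchBlock]

theorem flatMap_stretch_replicate (n : ℕ) :
    (List.replicate n Letter.zero).flatMap Letter.stretch = List.replicate n Letter.zero := by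
  induction n with
  | zero => rfl
  | succ n ih => simp [List.replicate_succ, Letter.stretch, ih]

theorem stretch_concatPrefix_alphaBlock (k : ℕ) :
    Letter.A :: Letter.zero :: (concatPrefix alphaBlock k).flatMap Letter.stretch
      = concatPrefix alphaBlock (k + 1) := by
  induction k with
  | zero => simp [concatPrefix, alphaBlock]
  | succ k ih =>
    rw [concatPrefix, List.flatMap_append, ← List.cons_append, ← List.cons_append, ih,
      concatPrefix.eq_2 _ (k + 1)]
    congr 1
    simp only [alphaBlock, List.flatMap_cons, flatMap_stretch_replicate, Letter.stretch]
    simp [List.replicate_succ]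

theorem isOmegaConcat_stretchBlock_alpha : IsOmegaConcat (stretchBlock alpha) alpha := by
  refine ⟨fun n i h => ?_, fun N => ⟨N, le_length_concatPrefix (stretchBlock_ne_nil _) N⟩⟩
  have hn : n ≤ rowStart (n + 1) := n.le_succ.trans (strictMono_rowStart.le_apply)
  have e : concatPrefix (stretchBlock alpha) (rowStart (n + 1))
      = concatPrefix alphaBlock (n + 2) := by
    obtain ⟨r, hr⟩ : ∃ r, rowStart (n + 1) = r + 1 :=
      ⟨rowStart (n + 1) - 1, by
        have := strictMono_rowStart.le_apply (x := n + 1)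
        omega⟩
    rw [hr, concatPrefix_stretchBlock, ← hr, ← stretch_concatPrefix_alphaBlock]
    rw [isOmegaConcat_alpha.concatPrefix_eq (n + 1)]
    rfl
  have hp := concatPrefix_prefix (stretchBlock alpha) hn
  rw [e] at hp
  rw [hp.getElem h]
  exact isOmegaConcat_alpha.1 _ _ _

/-- `alpha` is the only infinite word `u` with `u = A0.stretch (u 0).stretch (u 1) ⋯`. -/
theorem isOmegaConcat_stretchBlock_self_iff {u : OmegaWord Letter} :
    IsOmegaConcat (stretchBlock u) u ↔ u = alpha := by
  constructor
  · intro hu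
    -- agreement of `u` and `alpha` up to `n` forces agreement of the longer images
    have key : ∀ n, ∀ i < n, u i = alpha i := by
      intro n
      induction n with
      | zero => intro i hi; omega
      | succ n ih =>
        have hseg : slice u 0 n = slice alpha 0 n := by
          simp only [slice, List.ofFn_inj]
          funext j
          simpa using ih j j.2
        have hpre : ∃ l : List Letter, n < l.length ∧ (∀ i (h : i < l.length), l[i] = u i) ∧
            ∀ i (h : i < l.length), l[i] = alpha i := by
          cases n with
          | zero =>
            have h1 := hu.1 1
            have h2 := isOmegaConcat_stretchBlock_alpha.1 1
            simp only [concatPrefix, stretchBlock, List.nil_append] at h1 h2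
            refine ⟨[Letter.A], by simp, fun i h => ?_, fun i h => ?_⟩ <;>
              obtain rfl : i = 0 := by simpa using h
            · exact h1 0 (by simp)
            · exact h2 0 (by simp)
          | succ n =>
            refine ⟨_, ?_, hu.1 (n + 1), ?_⟩
            · have : ∀ w : List Letter, w.length ≤ (w.flatMap Letter.stretch).length := by
                intro w
                induction w with
                | nil => simp
                | cons x w ih =>
                  rw [List.flatMap_cons, List.length_append, List.length_cons]
                  have : 1 ≤ x.stretch.length := by cases x <;> simp [Letter.stretch]
                  omega
              have := this (slice u 0 (n + 1))
              rw [length_slice] at this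
              simp only [concatPrefix_stretchBlock, List.length_cons]
              omega
            · rw [concatPrefix_stretchBlock, hseg, ← concatPrefix_stretchBlock]
              exact isOmegaConcat_stretchBlock_alpha.1 _
        obtain ⟨l, hl, h1, h2⟩ := hpre
        intro i hi
        rw [← h1 i (by omega), h2]
    exact funext fun i => key (i + 1) i (by omega)
  · rintro rfl
    exact isOmegaConcat_stretchBlock_alpha

/-! ### The automaton -/

/-- `σ` is fading if, for every `m`, the letter at distance `m + 1` after an occurrence of `A` is
`0` for all but finitely many occurrences. If `σ` has its letters `A` at the same places as `alpha`,
this says that every column of the triangular array of the rows of `σ` has finitely many `1`s. -/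
def Fading (σ : OmegaWord Letter) : Prop :=
  ∀ m, ∀ᶠ n in atTop, σ n = Letter.A → σ (n + m + 1) = Letter.zero

/-- The pairs `(σ, u)` with `σ` fading, together with all pairs other than those in which
`u = alpha` and `σ` has its letters `A` exactly where `alpha` has them. -/
def fadingRelation : Set (OmegaWord Letter × OmegaWord Letter) :=
  {p | (fun n => (p.1 n).erase) = p.2 → p.2 = alpha → Fading p.1}

namespace FadingAutomaton

/-- The states of the automaton for `fadingRelation`. In `copying` and `stretching` the second tape
has so far been the image of the first one under `Letter.erase`, or has followed `stretchBlock`. In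
`free`, `hold` and `raise` the second head lags behind; in `hold` and `raise` the first head has
passed one letter `A` more than the second one, and `raise` is entered exactly when the lag has just
increased. In `done` everything is accepted. -/
inductive State
  | start
  | copying
  | stretching
  | raise
  | hold
  | free
  | done

open State Letter

instance : Finite State :=
  finite_univ_iff.1 ((toFinite {start, copying, stretching, raise, hold, free, done}).subset
    fun q _ => by cases q <;> simp)

/-- The moves of the two deterministic comparisons of the tapes, `Test q x w q'` meaning that in
state `q` the letter `x` on the first tape calls for `w` on the second tape. -/
inductive Test : State → Letter → List Letter → State → Prop
  | start_copy (x : Letter) : Test start x [x.erase] copying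
  | copy (x : Letter) : Test copying x [x.erase] copying
  | start_stretch (x : Letter) : Test start x (A :: zero :: x.stretch) stretching
  | stretch (x : Letter) : Test stretching x x.stretch stretching

theorem Test.length_le {q x w q'} (h : Test q x w q') : w.length ≤ 4 := by
  cases h <;> cases x <;> simp [Letter.stretch]

/-- The transitions of the automaton; each one reads a single letter of the first tape. -/
inductive Step : State → Letter → List Letter → State → Prop
  | pass {q x w q'} : Test q x w q' → Step q x w q'
  | fail {q x w w' q'} : Test q x w q' → w'.length = w.length → w' ≠ w → Step q x w' done
  | skip (x : Letter) (w : List Letter) : w.length ≤ 4 → Step done x w done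
  | copy_raise : Step copying A [] raise
  | raise_hold : Step raise zero [zero] hold
  | raise_free : Step raise zero [A] free
  | hold_hold : Step hold zero [zero] hold
  | hold_free : Step hold zero [A] free
  | free_free (x : Letter) : x ≠ A → Step free x [zero] free
  | free_hold : Step free A [zero] hold
  | free_raise : Step free A [] raise

theorem Step.length_le {q x w q'} (h : Step q x w q') : w.length ≤ 4 := by
  cases h with
  | pass h => exact h.length_le
  | fail h hl _ => exact hl.trans_le h.length_le
  | skip _ _ h => exact h
  | _ => simp

/-- The states of the part of the automaton in which the second head lags behind. -/
def State.IsLate (q : State) : Prop := q = raise ∨ q = hold ∨ q = free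

theorem Test.not_isLate {q x w q'} (h : Test q x w q') : ¬ q.IsLate := by
  cases h <;> simp [State.IsLate]

theorem Step.of_isLate {q x w q'} (h : Step q x w q') (hq : q.IsLate) :
    q'.IsLate ∧ w.length ≤ 1 := by
  cases h with
  | pass h => exact absurd hq h.not_isLate
  | fail h => exact absurd hq h.not_isLate
  | skip => simp [State.IsLate] at hq
  | _ => simp [State.IsLate]

theorem Step.eq_zero_of_hold {q x w q'} (h : Step q x w q') (hq : q = raise ∨ q = hold) :
    x = zero := by
  cases h with
  | pass h => exact absurd (hq.imp_right Or.inl) h.not_isLate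
  | fail h => exact absurd (hq.imp_right Or.inl) h.not_isLate
  | _ => simp_all

theorem Step.eq_nil_of_raise {q x w} (h : Step q x w raise) : w = [] ∧ x = A := by
  cases h with
  | pass h => cases h
  | _ => exact ⟨rfl, rfl⟩

end FadingAutomaton

open FadingAutomaton

/-- The 2-tape Büchi automaton accepting `fadingRelation`. -/
def fadingAutomaton : TwoTapeBuchi Letter Letter where
  K := State
  finite_K := inferInstance
  Δ := {t | ∃ x, t.2.1 = [x] ∧ Step t.1 x t.2.2.1 t.2.2.2}
  finite_Δ := by
    refine (finite_univ.prod ((List.finite_length_le Letter 1).prod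
      ((List.finite_length_le Letter 4).prod finite_univ))).subset ?_
    rintro ⟨q, a, w, q'⟩ ⟨x, rfl, h⟩
    exact ⟨mem_univ _, by simp, h.length_le, mem_univ _⟩
  q₀ := State.start
  F := {State.raise, State.done}

theorem mem_fadingAutomaton_relation_iff {σ u : OmegaWord Letter} :
    (σ, u) ∈ fadingAutomaton.relation ↔ ∃ (q : ℕ → State) (b : ℕ → List Letter),
      q 0 = State.start ∧ (∀ i, Step (q i) (σ i) (b i) (q (i + 1))) ∧ IsOmegaConcat b u ∧
        ∃ qf, (qf = State.raise ∨ qf = State.done) ∧ {i | q i = qf}.Infinite := by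
  constructor
  · rintro ⟨q, a, b, ⟨h0, hstep, ha, hb⟩, qf, hqf, hinf⟩
    choose x hx hs using hstep
    obtain rfl : a = fun i => [x i] := funext hx
    obtain rfl := isOmegaConcat_singleton_iff.1 ha
    exact ⟨q, b, h0, hs, hb, qf, hqf, hinf⟩
  · rintro ⟨q, b, h0, hs, hb, qf, hqf, hinf⟩
    exact ⟨q, fun i => [σ i], b, ⟨h0, fun i => ⟨σ i, rfl, hs i⟩,
      isOmegaConcat_singleton_iff.2 rfl, hb⟩, qf, hqf, hinf⟩

namespace FadingAutomaton

open State Letter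

/-! ### Pairs accepted because a comparison fails -/

theorem mem_relation_of_test {σ u : OmegaWord Letter} {out : ℕ → List Letter} {r : ℕ → State}
    (h0 : r 0 = start) (hr : ∀ i, Test (r i) (σ i) (out i) (r (i + 1)))
    (hne : ∀ i, out i ≠ []) (hu : ¬ IsOmegaConcat out u) :
    (σ, u) ∈ fadingAutomaton.relation := by
  classical
  -- the second tape is cut into factors of the expected lengths
  set P : ℕ → ℕ := fun i => (concatPrefix out i).length with hP
  have hPs : ∀ i, P (i + 1) - P i = (out i).length := fun i => by simp [hP, concatPrefix]
  have hb := isOmegaConcat_slice u (P := P) rfl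
    (monotone_nat_of_le_succ fun i => by simp [hP, concatPrefix])
    fun N => ⟨N, le_length_concatPrefix hne N⟩
  simp only [hPs] at hb
  have hex : ∃ k, slice u (P k) (out k).length ≠ out k := by
    by_contra! h
    rw [funext h] at hb
    exact hu hb
  have hlt : ∀ i < Nat.find hex, slice u (P i) (out i).length = out i := fun i hi =>
    not_not.1 (Nat.find_min hex hi)
  have hk := Nat.find_spec hex
  generalize Nat.find hex = k at hlt hk
  refine mem_fadingAutomaton_relation_iff.2
    ⟨fun i => if i ≤ k then r i else done, _, by simp [h0], fun i => ?_, hb, done, Or.inr rfl, ?_⟩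
  · change Step (if i ≤ k then r i else done) _ _ (if i + 1 ≤ k then r (i + 1) else done)
    rcases lt_trichotomy i k with h | rfl | h
    · rw [if_pos h.le, if_pos (Nat.succ_le_of_lt h), hlt i h]
      exact .pass (hr i)
    · rw [if_pos le_rfl, if_neg (by omega)]
      exact .fail (hr i) (by simp) hk
    · rw [if_neg (by omega), if_neg (by omega)]
      exact .skip _ _ (by simpa using (hr i).length_le)
  · refine (Ioi_infinite k).mono fun i (hi : k < i) => ?_
    simp [hi.not_ge]

theorem mem_relation_of_ne_erase {σ u : OmegaWord Letter} (h : (fun n => (σ n).erase) ≠ u) :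
    (σ, u) ∈ fadingAutomaton.relation :=
  mem_relation_of_test (out := fun n => [(σ n).erase])
    (r := fun | 0 => start | _ + 1 => copying) rfl
    (fun | 0 => .start_copy _ | _ + 1 => .copy _) (by simp)
    (mt isOmegaConcat_singleton_iff.1 h)

theorem mem_relation_of_ne_alpha {σ u : OmegaWord Letter} (h : (fun n => (σ n).erase) = u)
    (hu : u ≠ alpha) : (σ, u) ∈ fadingAutomaton.relation :=
  mem_relation_of_test (out := stretchBlock σ)
    (r := fun | 0 => start | _ + 1 => stretching) rfl
    (fun | 0 => .start_stretch _ | _ + 1 => .stretch _) (stretchBlock_ne_nil σ) (by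
      rw [← stretchBlock_erase, h]
      exact mt isOmegaConcat_stretchBlock_self_iff.1 hu)

/-! ### Runs over fading words -/

/-- The situation, after `i` letters of `σ` and `i - d` letters of `alpha`, of the run constructed
on a fading word: the next `d` letters after the coming letters `A`, and after the letter `A`
between the two heads if there is one, are `0`. -/
def Sound (σ : OmegaWord Letter) (i : ℕ) (q : State) (d : ℕ) : Prop :=
  match q with
  | start => i = 0 ∧ d = 0
  | copying => d = 0
  | raise | hold => d ≤ i ∧ (∀ n, i ≤ n → σ n = A → ∀ k < d, σ (n + k + 1) = zero) ∧
      ∃ n, i ≤ n + d ∧ n < i ∧ alpha n = A ∧ (∀ k, i ≤ k + d → k < i → alpha k = A → k = n) ∧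
        ∀ k < d, σ (n + k + 1) = zero
  | free => d ≤ i ∧ 0 < d ∧ (∀ n, i ≤ n → σ n = A → ∀ k < d, σ (n + k + 1) = zero) ∧
      ∀ k, i ≤ k + d → k < i → alpha k ≠ A
  | stretching | done => False

theorem Sound.exists_step_of_hold {σ : OmegaWord Letter} (hσ : (fun n => (σ n).erase) = alpha)
    {i d : ℕ} (h : Sound σ i hold d) :
    σ i = zero ∧ (alpha (i - d) = A ∧ Sound σ (i + 1) free d ∨
      alpha (i - d) = zero ∧ Sound σ (i + 1) hold d) := by
  obtain ⟨hdi, hfrom, n, hn, hni, hnA, huniq, hz⟩ := h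
  have hi : σ i = zero := by
    have := hz (i - n - 1) (by omega)
    rwa [show n + (i - n - 1) + 1 = i by omega] at this
  have hi' : alpha i ≠ A := fun h => by rw [← eq_A_iff_of_erase hσ, hi] at h; cases h
  refine ⟨hi, ?_⟩
  by_cases ha : alpha (i - d) = A
  · refine Or.inl ⟨ha, by omega, by omega, fun n' hn' => hfrom n' (by omega), ?_⟩
    intro k hk hki hkA
    rcases (Nat.lt_succ_iff.1 hki).lt_or_eq with h | rfl
    · have := huniq k (by omega) h hkA
      have := huniq (i - d) (by omega) (by omega) ha
      omega
    · exact hi' hkA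
  · have hne : n ≠ i - d := fun h => ha (h ▸ hnA)
    refine Or.inr ⟨alpha_eq_zero ha, by omega, fun n' hn' => hfrom n' (by omega), n, by omega,
      by omega, hnA, ?_, hz⟩
    intro k hk hki hkA
    rcases (Nat.lt_succ_iff.1 hki).lt_or_eq with h | rfl
    · exact huniq k (by omega) h hkA
    · exact absurd hkA hi'

theorem Sound.exists_step {σ : OmegaWord Letter} (hσ : (fun n => (σ n).erase) = alpha)
    {T : ℕ → ℕ} (hT : ∀ d n, T d ≤ n → σ n = A → ∀ k < d + 1, σ (n + k + 1) = zero)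
    {i : ℕ} {q : State} {d : ℕ} (h : Sound σ i q d) :
    ∃ q' d', Sound σ (i + 1) q' d' ∧
      (q' ≠ raise ∧ d' = d ∧ Step q (σ i) [alpha (i - d)] q' ∨
        q' = raise ∧ d' = d + 1 ∧ Step q (σ i) [] raise) ∧
      (σ i = A → T d < i → q' = raise) := by
  have hA := eq_A_iff_of_erase hσ
  have hcopy : ∀ {r}, Test r (σ i) [(σ i).erase] copying → Step r (σ i) [alpha i] copying :=
    fun {r} t => by rw [← hσ]; exact .pass t
  cases q with
  | start =>
    obtain ⟨rfl, rfl⟩ := h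
    exact ⟨copying, 0, rfl, Or.inl ⟨by simp, rfl, hcopy (.start_copy _)⟩, fun _ h => by omega⟩
  | copying =>
    obtain rfl : d = 0 := h
    by_cases hi : σ i = A ∧ T 0 < i
    · refine ⟨raise, 1, ⟨by omega, fun n hn hnA => hT 0 n (by omega) hnA, i, le_rfl, by omega,
        (hA i).1 hi.1, by omega, hT 0 i (by omega) hi.1⟩, Or.inr ⟨rfl, rfl, ?_⟩, fun _ _ => rfl⟩
      rw [hi.1]
      exact .copy_raise
    · exact ⟨copying, 0, rfl, Or.inl ⟨by simp, rfl, hcopy (.copy _)⟩, fun h h' => absurd ⟨h, h'⟩ hi⟩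
  | stretching => exact h.elim
  | done => exact h.elim
  | raise =>
    rcases Sound.exists_step_of_hold hσ (i := i) (d := d) h with ⟨hi, ⟨ha, hs⟩ | ⟨ha, hs⟩⟩ <;>
      refine ⟨_, d, hs, Or.inl ⟨by simp, rfl, ?_⟩, by simp [hi]⟩ <;> rw [hi, ha]
    exacts [.raise_free, .raise_hold]
  | hold =>
    rcases Sound.exists_step_of_hold hσ (i := i) (d := d) h with ⟨hi, ⟨ha, hs⟩ | ⟨ha, hs⟩⟩ <;>
      refine ⟨_, d, hs, Or.inl ⟨by simp, rfl, ?_⟩, by simp [hi]⟩ <;> rw [hi, ha]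
    exacts [.hold_free, .hold_hold]
  | free =>
    obtain ⟨hdi, hd, hfrom, hno⟩ := h
    have ha : alpha (i - d) = zero := alpha_eq_zero (hno _ (by omega) (by omega))
    by_cases hi : σ i = A
    · have huniq : ∀ k, i ≤ k + d → k < i + 1 → alpha k = A → k = i := fun k hk hki hkA => by
        by_contra hne
        exact hno k hk (by omega) hkA
      by_cases hTi : T d < i
      · refine ⟨raise, d + 1, ⟨by omega, fun n hn hnA => hT d n (by omega) hnA, i, by omega,
          by omega, (hA i).1 hi, fun k hk => huniq k (by omega), hT d i (by omega) hi⟩,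
          Or.inr ⟨rfl, rfl, ?_⟩, fun _ _ => rfl⟩
        rw [hi]
        exact .free_raise
      · refine ⟨hold, d, ⟨by omega, fun n hn hnA => hfrom n (by omega) hnA, i, by omega,
          by omega, (hA i).1 hi, fun k hk => huniq k (by omega), hfrom i le_rfl hi⟩,
          Or.inl ⟨by simp, rfl, ?_⟩, fun _ h => absurd h hTi⟩
        rw [hi, ha]
        exact .free_hold
    · refine ⟨free, d, ⟨by omega, hd, fun n hn hnA => hfrom n (by omega) hnA, ?_⟩,
        Or.inl ⟨by simp, rfl, ?_⟩, fun h => absurd h hi⟩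
      · intro k hk hki hkA
        rcases (Nat.lt_succ_iff.1 hki).lt_or_eq with h | rfl
        · exact hno k (by omega) h hkA
        · exact hi ((hA k).2 hkA)
      · rw [ha]
        exact .free_free _ hi

theorem mem_relation_of_fading {σ : OmegaWord Letter} (hσ : (fun n => (σ n).erase) = alpha)
    (hf : Fading σ) : (σ, alpha) ∈ fadingAutomaton.relation := by
  have hex : ∀ d, ∃ N, ∀ n, N ≤ n → σ n = A → ∀ k < d + 1, σ (n + k + 1) = zero := fun d => by
    refine eventually_atTop.1 ?_
    filter_upwards [(finite_Iio (d + 1)).eventually_all.2 fun k _ => hf k] with n hn hnA k hk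
      using hn k hk hnA
  choose T hT using hex
  have hnext : ∀ i (c : State × ℕ), ∃ c' : State × ℕ, Sound σ i c.1 c.2 →
      Sound σ (i + 1) c'.1 c'.2 ∧
      (c'.1 ≠ raise ∧ c'.2 = c.2 ∧ Step c.1 (σ i) [alpha (i - c.2)] c'.1 ∨
        c'.1 = raise ∧ c'.2 = c.2 + 1 ∧ Step c.1 (σ i) [] raise) ∧
      (σ i = A → T c.2 < i → c'.1 = raise) := by
    intro i c
    by_cases hc : Sound σ i c.1 c.2
    · obtain ⟨q', d', h⟩ := hc.exists_step hσ hT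
      exact ⟨(q', d'), fun _ => h⟩
    · exact ⟨c, fun h => absurd h hc⟩
  choose next hnext using hnext
  let c : ℕ → State × ℕ := fun i => Nat.rec (start, 0) next i
  have hc : ∀ i, Sound σ i (c i).1 (c i).2 := by
    intro i
    induction i with
    | zero => exact ⟨rfl, rfl⟩
    | succ i ih => exact (hnext i _ ih).1
  have hstep := fun i => (hnext i _ (hc i)).2.1
  have hrise := fun i => (hnext i _ (hc i)).2.2
  change ∀ i, (c (i + 1)).1 ≠ raise ∧ (c (i + 1)).2 = (c i).2 ∧
    Step (c i).1 (σ i) [alpha (i - (c i).2)] (c (i + 1)).1 ∨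
    (c (i + 1)).1 = raise ∧ (c (i + 1)).2 = (c i).2 + 1 ∧ Step (c i).1 (σ i) [] raise at hstep
  change ∀ i, σ i = A → T (c i).2 < i → (c (i + 1)).1 = raise at hrise
  have hle : ∀ i, (c i).2 ≤ i := by
    intro i
    induction i with
    | zero => exact le_rfl
    | succ i ih => rcases hstep i with ⟨_, h, _⟩ | ⟨_, h, _⟩ <;> omega
  have hmono : Monotone fun i => i - (c i).2 := monotone_nat_of_le_succ fun i => by
    have := hle i
    rcases hstep i with ⟨_, h, _⟩ | ⟨_, h, _⟩ <;> omega
  -- the second head never rests twice in a row, since there is no empty move out of `raise`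
  have htwo : ∀ i, i - (c i).2 < i + 2 - (c (i + 2)).2 := by
    intro i
    have := hle i
    rcases hstep i with ⟨_, h, _⟩ | ⟨hr, h, _⟩ <;>
      rcases hstep (i + 1) with ⟨_, h', _⟩ | ⟨_, h', hs⟩
    · rw [show i + 2 = i + 1 + 1 from rfl]; omega
    · rw [show i + 2 = i + 1 + 1 from rfl]; omega
    · rw [show i + 2 = i + 1 + 1 from rfl]; omega
    · rw [hr] at hs
      have h0 := hs.eq_zero_of_hold (Or.inl rfl)
      rw [hs.eq_nil_of_raise.2] at h0
      cases h0
  have hunb : ∀ N, ∃ n, N ≤ n - (c n).2 := by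
    intro N
    induction N with
    | zero => exact ⟨0, Nat.zero_le _⟩
    | succ N ih =>
      obtain ⟨n, hn⟩ := ih
      exact ⟨n + 2, hn.trans_lt (htwo n)⟩
  refine mem_fadingAutomaton_relation_iff.2 ⟨fun i => (c i).1, _, rfl, fun i => ?_,
    isOmegaConcat_slice alpha (P := fun i => i - (c i).2) rfl hmono hunb, raise, Or.inl rfl, ?_⟩
  · change Step (c i).1 _ _ (c (i + 1)).1
    have := hle i
    rcases hstep i with ⟨_, h, hs⟩ | ⟨hr, h, hs⟩
    · rwa [show i + 1 - (c (i + 1)).2 - (i - (c i).2) = 1 by omega, slice_one]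
    · rwa [show i + 1 - (c (i + 1)).2 - (i - (c i).2) = 0 by omega, slice_zero, hr]
  · refine infinite_of_not_bddAbove fun ⟨M, hM⟩ => ?_
    have hnot : ∀ i, M < i → (c i).1 ≠ raise := fun i hi h => (hM h).not_gt hi
    have hconst : ∀ i, M ≤ i → (c i).2 = (c M).2 := fun i hi => by
      induction i, hi using Nat.le_induction with
      | base => rfl
      | succ i hi ih =>
        rcases hstep i with ⟨_, h, _⟩ | ⟨h, _⟩
        · rw [h, ih]
        · exact absurd h (hnot (i + 1) (by omega))
    obtain ⟨r, hr, hrA⟩ : ∃ r, max M (T (c M).2) < r ∧ σ r = A :=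
      ⟨_, Nat.lt_of_succ_le strictMono_rowStart.le_apply,
        (eq_A_iff_of_erase hσ _).2 (alpha_rowStart _)⟩
    obtain ⟨hM', hT'⟩ := max_lt_iff.1 hr
    exact hnot (r + 1) (by omega) (hrise r hrA (by rwa [hconst r hM'.le]))

/-! ### Accepting runs over `alpha` -/

/-- The relation between the state and the positions `i` and `p` of the two heads in any run over
`(σ, alpha)`, where `σ` is a word over the rows of `alpha`: between the two heads there is exactly
one letter `A` in the states `raise` and `hold`, and none in the state `free`. -/
def Lag (q : State) (i p : ℕ) : Prop :=
  match q with
  | start => i = 0 ∧ p = 0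
  | copying => p = i
  | stretching => 0 < i ∧ p = (concatPrefix (stretchBlock alpha) i).length
  | raise | hold => p ≤ i ∧
      ∃ n, p ≤ n ∧ n < i ∧ alpha n = A ∧ ∀ k, p ≤ k → k < i → alpha k = A → k = n
  | free => p ≤ i ∧ ∀ k, p ≤ k → k < i → alpha k ≠ A
  | done => False

theorem Lag.of_test {σ : OmegaWord Letter} (hσ : (fun n => (σ n).erase) = alpha) {i p : ℕ}
    {q q' : State} {w : List Letter} (h : Lag q i p) (ht : Test q (σ i) w q') :
    w = slice alpha p w.length ∧ Lag q' (i + 1) (p + w.length) := by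
  have hi : (σ i).erase = alpha i := congrFun hσ i
  have hsb : stretchBlock alpha = stretchBlock σ := by rw [← stretchBlock_erase σ, hσ]
  have hs := isOmegaConcat_stretchBlock_alpha.eq_slice i
  rw [hsb] at hs
  cases ht with
  | start_copy =>
    obtain ⟨rfl, rfl⟩ := h
    simp [hi, Lag]
  | copy =>
    obtain rfl : p = i := h
    simp [hi, Lag]
  | start_stretch =>
    obtain ⟨rfl, rfl⟩ := h
    exact ⟨hs, by simp, by rw [hsb]; simp [concatPrefix, stretchBlock]⟩
  | stretch =>
    obtain ⟨h0, rfl⟩ := h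
    obtain ⟨j, rfl⟩ := Nat.exists_eq_succ_of_ne_zero h0.ne'
    rw [hsb]
    exact ⟨hs, by simp, by rw [hsb]; simp [concatPrefix, stretchBlock, Nat.add_assoc]⟩

theorem Lag.step {σ : OmegaWord Letter} (hσ : (fun n => (σ n).erase) = alpha) {i p : ℕ}
    {q q' : State} {w : List Letter} (h : Lag q i p) (hs : Step q (σ i) w q')
    (hw : w = slice alpha p w.length) : Lag q' (i + 1) (p + w.length) := by
  have hA := eq_A_iff_of_erase hσ i
  have hlt : ∀ {k}, k < i + 1 → k = i ∨ k < i := fun {k} hk => by omega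
  have hold_step : σ i = zero → w = [zero] → Lag hold i p → Lag hold (i + 1) (p + 1) := by
    rintro hi rfl ⟨hpi, n, hpn, hni, hnA, huniq⟩
    have hp : zero = alpha p := by simpa using hw
    have hne : p ≠ n := by rintro rfl; rw [hnA] at hp; cases hp
    refine ⟨by omega, n, by omega, by omega, hnA, fun k hk hki hkA => ?_⟩
    rcases hlt hki with rfl | h
    · rw [← hA, hi] at hkA; cases hkA
    · exact huniq k (by omega) h hkA
  have free_step : σ i = zero → w = [A] → Lag hold i p → Lag free (i + 1) (p + 1) := by
    rintro hi rfl ⟨hpi, n, hpn, hni, hnA, huniq⟩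
    have hp : A = alpha p := by simpa using hw
    have := huniq p le_rfl (by omega) hp.symm
    refine ⟨by omega, fun k hk hki hkA => ?_⟩
    rcases hlt hki with rfl | h
    · rw [← hA, hi] at hkA; cases hkA
    · have := huniq k (by omega) h hkA
      omega
  generalize hx : σ i = x at hs
  cases hs with
  | pass ht => exact (h.of_test hσ (hx ▸ ht)).2
  | fail ht hl hne => exact hne (hw.trans (by rw [hl]; exact (h.of_test hσ (hx ▸ ht)).1.symm))
  | skip => exact h.elim
  | copy_raise =>
    obtain rfl : p = i := h
    exact ⟨by simp, p, by simp, by simp, hA.1 hx, fun k hk hki _ => by simp at hk; omega⟩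
  | raise_hold => exact hold_step hx rfl h
  | raise_free => exact free_step hx rfl h
  | hold_hold => exact hold_step hx rfl h
  | hold_free => exact free_step hx rfl h
  | free_free _ hxA =>
    obtain ⟨hpi, hno⟩ := h
    refine ⟨by simpa using hpi, fun k hk hki hkA => ?_⟩
    simp only [List.length_cons, List.length_nil] at hk
    rcases hlt hki with rfl | h
    · exact hxA (hx ▸ hA.2 hkA)
    · exact hno k (by omega) h hkA
  | free_hold =>
    obtain ⟨hpi, hno⟩ := h
    have hp : zero = alpha p := by simpa using hw
    have hne : p ≠ i := by rintro rfl; rw [hA.1 hx] at hp; cases hp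
    refine ⟨by simpa using hpi, i, by simp; omega, by omega, hA.1 hx, fun k hk hki hkA => ?_⟩
    simp only [List.length_cons, List.length_nil] at hk
    by_contra hk'
    exact hno k (by omega) (by omega) hkA
  | free_raise =>
    obtain ⟨hpi, hno⟩ := h
    refine ⟨by simp; omega, i, by simpa using hpi, by omega, hA.1 hx, fun k hk hki hkA => ?_⟩
    simp only [List.length_nil] at hk
    by_contra hk'
    exact hno k (by omega) (by omega) hkA

theorem fading_of_mem_relation {σ : OmegaWord Letter} (hσ : (fun n => (σ n).erase) = alpha)
    (h : (σ, alpha) ∈ fadingAutomaton.relation) : Fading σ := by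
  obtain ⟨q, b, h0, hs, hb, qf, hqf, hinf⟩ := mem_fadingAutomaton_relation_iff.1 h
  set P : ℕ → ℕ := fun i => (concatPrefix b i).length with hP
  have hPs : ∀ i, P (i + 1) = P i + (b i).length := fun i => by simp [hP, concatPrefix]
  have hlag : ∀ i, Lag (q i) i (P i) := by
    intro i
    induction i with
    | zero => rw [h0]; exact ⟨rfl, rfl⟩
    | succ i ih => rw [hPs]; exact ih.step hσ (hs i) (hb.eq_slice i)
  obtain rfl : qf = raise := by
    refine hqf.resolve_right ?_
    rintro rfl
    obtain ⟨i, hi⟩ := hinf.nonempty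
    have := hlag i
    rw [show q i = done from hi] at this
    exact this
  obtain ⟨i₀, hi₀⟩ := hinf.nonempty
  have hlate : ∀ i, i₀ ≤ i → (q i).IsLate := fun i hi => by
    induction i, hi using Nat.le_induction with
    | base => exact Or.inl hi₀
    | succ i hi ih => exact ((hs i).of_isLate ih).1
  have hgrow : ∀ m, ∃ N, i₀ ≤ N ∧ ∀ i, N ≤ i → P i + m ≤ i := by
    intro m
    induction m with
    | zero =>
      refine ⟨i₀, le_rfl, fun i hi => ?_⟩
      have := hlag i
      rcases hlate i hi with h | h | h <;> rw [h] at this <;> exact this.1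
    | succ m ih =>
      obtain ⟨N, hN, ih⟩ := ih
      obtain ⟨j, hj, hNj⟩ := hinf.exists_gt N
      obtain ⟨j, rfl⟩ := Nat.exists_eq_succ_of_ne_zero (by omega : j ≠ 0)
      refine ⟨j + 1, by omega, fun i hi => ?_⟩
      induction i, hi using Nat.le_induction with
      | base =>
        have hsj := hs j
        rw [show q (j + 1) = raise from hj] at hsj
        rw [hPs, hsj.eq_nil_of_raise.1]
        have := ih j (by omega)
        simp only [List.length_nil]
        omega
      | succ i hi ih' =>
        have := ((hs i).of_isLate (hlate i (by omega))).2
        rw [hPs]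
        omega
  intro m
  obtain ⟨N, hN, hm⟩ := hgrow (m + 1)
  filter_upwards [eventually_ge_atTop N] with n hn hnA
  -- the letter `A` at `n` lies between the two heads, so that the automaton is holding
  have hl := hlag (n + m + 1)
  have hst := hs (n + m + 1)
  have := hm (n + m + 1) (by omega)
  rcases hlate (n + m + 1) (by omega) with h | h | h
  · exact hst.eq_zero_of_hold (Or.inl h)
  · exact hst.eq_zero_of_hold (Or.inr h)
  · rw [h] at hl
    exact absurd ((eq_A_iff_of_erase hσ n).1 hnA) (hl.2 n (by omega) (by omega))

end FadingAutomaton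

open FadingAutomaton

theorem fadingAutomaton_relation : fadingAutomaton.relation = fadingRelation := by
  ext ⟨σ, u⟩
  constructor
  · intro h (hσ : (fun n => (σ n).erase) = u) (hu : u = alpha)
    subst hu
    exact fading_of_mem_relation hσ h
  · intro h
    by_cases h1 : (fun n => (σ n).erase) = u
    · by_cases h2 : u = alpha
      · have hf : Fading σ := h h1 h2
        subst h2
        exact mem_relation_of_fading h1 hf
      · exact mem_relation_of_ne_alpha h1 h2
    · exact mem_relation_of_ne_erase h1

/-! ### The class `Π⁰₃` -/

theorem preimage_mem_borelClasses {X Y : Type} [TopologicalSpace X] [TopologicalSpace Y]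
    {f : X → Y} (hf : Continuous f) (n : ℕ) :
    (∀ s ∈ (borelClasses Y n).1, f ⁻¹' s ∈ (borelClasses X n).1) ∧
      ∀ s ∈ (borelClasses Y n).2, f ⁻¹' s ∈ (borelClasses X n).2 := by
  induction n with
  | zero => simp [borelClasses]
  | succ n ih =>
    cases n with
    | zero => exact ⟨fun s hs => hs.preimage hf, fun s hs => hs.preimage hf⟩
    | succ n =>
      constructor
      · rintro s ⟨F, hF, rfl⟩
        exact ⟨fun i => f ⁻¹' F i, fun i => ih.2 _ (hF i), preimage_iUnion⟩
      · rintro s ⟨F, hF, rfl⟩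
        exact ⟨fun i => f ⁻¹' F i, fun i => ih.1 _ (hF i), preimage_iInter⟩

theorem IsPi0.preimage {X Y : Type} [TopologicalSpace X] [TopologicalSpace Y] {n : ℕ} {s : Set Y}
    (hs : IsPi0 n s) {f : X → Y} (hf : Continuous f) : IsPi0 n (f ⁻¹' s) :=
  (preimage_mem_borelClasses hf n).2 s hs

theorem isPi0_three_iff {X : Type} [TopologicalSpace X] {s : Set X} :
    IsPi0 3 s ↔ ∃ F : ℕ → ℕ → Set X, (∀ m k, IsClosed (F m k)) ∧ s = ⋂ m, ⋃ k, F m k := by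
  constructor
  · rintro ⟨S, hS, rfl⟩
    choose F hF hSF using hS
    exact ⟨F, hF, iInter_congr hSF⟩
  · rintro ⟨F, hF, rfl⟩
    exact ⟨fun m => ⋃ k, F m k, fun m => ⟨F m, hF m, rfl⟩, rfl⟩

theorem isClopen_of_prefix {Y : Type} [TopologicalSpace Y] [DiscreteTopology Y] (n : ℕ)
    {S : Set (OmegaWord Y)} (h : ∀ x y : OmegaWord Y, (∀ i < n, x i = y i) → x ∈ S → y ∈ S) :
    IsClopen S := by
  let r : OmegaWord Y → Fin n → Y := fun x i => x i
  have hr : Continuous r := by fun_prop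
  have hS : S = r ⁻¹' (r '' S) := by
    refine (subset_preimage_image r S).antisymm ?_
    rintro y ⟨x, hx, hxy⟩
    exact h x y (fun i hi => congrFun hxy ⟨i, hi⟩) hx
  rw [hS]
  exact (isClopen_discrete _).preimage hr

theorem IsClosed.mem_of_forall_prefix {Y : Type} [TopologicalSpace Y] [DiscreteTopology Y]
    {F : Set (OmegaWord Y)} (hF : IsClosed F) {x : OmegaWord Y}
    (h : ∀ n, ∃ y ∈ F, ∀ i < n, y i = x i) : x ∈ F := by
  choose y hyF hy using h
  refine hF.mem_of_tendsto (f := y) (b := atTop) (tendsto_pi_nhds.2 fun i => ?_)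
    (Eventually.of_forall hyF)
  refine tendsto_const_nhds.congr' ?_
  filter_upwards [eventually_gt_atTop i] with n hn using (hy n i hn).symm

/-- A family of decreasing sequences `U k` of propositions has a member that always holds if and
only if the least index `k` not refuted up to time `n` changes only finitely often. -/
theorem exists_forall_iff_eventually_find_eq {U : ℕ → ℕ → Prop}
    (hU : ∀ k, Antitone (U k)) {g : ℕ → ℕ}
    (hg : ∀ n, IsLeast {k | n ≤ k ∨ U k n} (g n)) :
    (∃ k, ∀ n, U k n) ↔ ∀ᶠ n in atTop, g (n + 1) = g n := by
  constructor
  · rintro ⟨k, hk⟩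
    have hmono : Monotone g := monotone_nat_of_le_succ fun n => by
      refine (hg n).2 ?_
      rcases (hg (n + 1)).1 with h | h
      · exact Or.inl (by omega)
      · exact Or.inr (hU _ n.le_succ h)
    have hle : ∀ n, g n ≤ k := fun n => (hg n).2 (Or.inr (hk n))
    -- a bounded monotone sequence of integers stabilizes at its maximum
    obtain ⟨N, hN⟩ : ∃ N, ∀ n, g n ≤ g N := by
      have hfin : (range g).Finite := (finite_Iic k).subset (by rintro _ ⟨n, rfl⟩; exact hle n)
      obtain ⟨_, ⟨N, rfl⟩, hN⟩ := hfin.exists_maximal (range_nonempty g)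
      exact ⟨N, fun n => (le_total (g n) (g N)).elim id fun h => hN ⟨n, rfl⟩ h⟩
    filter_upwards [eventually_ge_atTop N] with n hn
    have := hmono hn
    have := hmono n.le_succ
    have := hN (n + 1)
    simp only [Nat.succ_eq_add_one] at *
    omega
  · intro h
    obtain ⟨N, hN⟩ := eventually_atTop.1 h
    have hconst : ∀ n, N ≤ n → g n = g N := fun n hn => by
      induction n, hn using Nat.le_induction with
      | base => rfl
      | succ n hn ih => rw [hN n hn, ih]
    refine ⟨g N, fun n => ?_⟩
    have hm := (hg (max n (max N (g N + 1)))).1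
    rw [hconst _ ((le_max_left _ _).trans (le_max_right _ _))] at hm
    rcases hm with hm | hm
    · have := (le_max_right N (g N + 1)).trans ((le_max_right n _).trans hm)
      omega
    · exact hU _ (le_max_left _ _) hm

/-- Every `Π⁰₃` set of infinite words reduces to "every column of an infinite `0`-`1` matrix has
finitely many ones", by clopen conditions: `X m n` says that the entry `(m, n)` is one. -/
theorem IsPi0.exists_clopen_matrix {Y : Type} [TopologicalSpace Y] [DiscreteTopology Y]
    {E : Set (OmegaWord Y)} (hE : IsPi0 3 E) :
    ∃ X : ℕ → ℕ → Set (OmegaWord Y), (∀ m n, IsClopen (X m n)) ∧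
      ∀ x, x ∈ E ↔ ∀ m, ∀ᶠ n in atTop, x ∉ X m n := by
  classical
  obtain ⟨F, hF, rfl⟩ := isPi0_three_iff.1 hE
  let U : ℕ → OmegaWord Y → ℕ → ℕ → Prop := fun m x k n => ∃ y ∈ F m k, ∀ i < n, y i = x i
  have hex : ∀ m x n, ∃ k, n ≤ k ∨ U m x k n := fun m x n => ⟨n, Or.inl le_rfl⟩
  let g : ℕ → OmegaWord Y → ℕ → ℕ := fun m x n => Nat.find (hex m x n)
  have hcongr : ∀ m n (x y : OmegaWord Y), (∀ i < n, x i = y i) → g m x n = g m y n := by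
    intro m n x y hxy
    refine Nat.find_congr' fun {k} => or_congr Iff.rfl (exists_congr fun z =>
      and_congr_right fun _ => forall₂_congr fun i hi => ?_)
    rw [hxy i hi]
  refine ⟨fun m n => {x | g m x (n + 1) ≠ g m x n}, fun m n => ?_, fun x => ?_⟩
  · refine isClopen_of_prefix (n + 1) fun x y hxy hx => ?_
    have h1 := hcongr m (n + 1) x y hxy
    have h2 := hcongr m n x y fun i hi => hxy i (by omega)
    simpa only [mem_ofPred_eq, h1, h2] using hx
  · simp only [mem_iInter, mem_iUnion, mem_ofPred_eq, not_not]
    refine forall_congr' fun m => ?_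
    have hU : ∀ k, Antitone (U m x k) := fun k a b hab ⟨y, hy, h⟩ =>
      ⟨y, hy, fun i hi => h i (by omega)⟩
    have hg : ∀ n, IsLeast {k | n ≤ k ∨ U m x k n} (g m x n) := fun n =>
      ⟨Nat.find_spec (hex m x n), fun k hk => Nat.find_min' _ hk⟩
    rw [← exists_forall_iff_eventually_find_eq hU hg]
    refine exists_congr fun k => ⟨fun hx n => ⟨x, hx, fun _ _ => rfl⟩, fun h => ?_⟩
    exact (hF m k).mem_of_forall_prefix h

/-! ### Completeness -/

theorem isPi0_fadingRelation : IsPi0 3 fadingRelation := by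
  refine isPi0_three_iff.2 ⟨fun m N =>
    (⋃ j ∈ Iic N, (fun p => (p.1 j, p.2 j)) ⁻¹'
      {y : Letter × Letter | ¬ (y.1.erase = y.2 ∧ y.2 = alpha j)}) ∪
    ⋂ n ∈ Ici N, (fun p => (p.1 n, p.1 (n + m + 1))) ⁻¹'
      {y : Letter × Letter | y.1 = Letter.A → y.2 = Letter.zero}, fun m N => ?_, ?_⟩
  · exact ((finite_Iic N).isClosed_biUnion fun j _ =>
        (isClosed_discrete _).preimage (by fun_prop)).union
      (isClosed_biInter fun n _ => (isClosed_discrete _).preimage (by fun_prop))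
  · ext ⟨σ, u⟩
    simp only [mem_iInter, mem_iUnion, mem_union, mem_preimage, mem_ofPred_eq, mem_Iic, mem_Ici]
    constructor
    · intro h m
      by_cases hs : ∀ j, (σ j).erase = u j ∧ u j = alpha j
      · have hf : Fading σ := h (funext fun j => (hs j).1) (funext fun j => (hs j).2)
        obtain ⟨N, hN⟩ := eventually_atTop.1 (hf m)
        exact ⟨N, Or.inr hN⟩
      · obtain ⟨j, hj⟩ := not_forall.1 hs
        exact ⟨j, Or.inl ⟨j, le_rfl, hj⟩⟩
    · intro h h1 h2 m
      obtain ⟨N, ⟨j, -, hj⟩ | hN⟩ := h m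
      · exact absurd ⟨congrFun h1 j, congrFun h2 j⟩ hj
      · exact eventually_atTop.2 ⟨N, hN⟩

open Classical in
/-- The word over the rows of `alpha` whose letter number `m` of the row number `k ≥ m` is `1` if
`x ∈ X m k`, and `0` otherwise. -/
noncomputable def encodeMatrix {Z : Type} (X : ℕ → ℕ → Set Z) (x : Z) : OmegaWord Letter := fun i =>
  if ∃ k m, m ≤ k ∧ i = rowStart k + m + 1 ∧ x ∈ X m k then Letter.one else alpha i

theorem encodeMatrix_rowStart {Z : Type} (X : ℕ → ℕ → Set Z) (x : Z) (k : ℕ) :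
    encodeMatrix X x (rowStart k) = Letter.A := by
  rw [encodeMatrix, if_neg, alpha_rowStart]
  rintro ⟨k', m, hm, e, -⟩
  have := alpha_rowStart k
  rw [e, alpha_rowStart_add_succ hm] at this
  cases this

open Classical in
theorem encodeMatrix_rowStart_add_succ {Z : Type} (X : ℕ → ℕ → Set Z) (x : Z) {k m : ℕ}
    (hm : m ≤ k) :
    encodeMatrix X x (rowStart k + m + 1) = if x ∈ X m k then Letter.one else Letter.zero := by
  rw [encodeMatrix, alpha_rowStart_add_succ hm]
  refine if_congr ⟨?_, fun hx => ⟨k, m, hm, rfl, hx⟩⟩ rfl rfl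
  rintro ⟨k', m', hm', e, hx⟩
  obtain ⟨rfl, rfl⟩ := row_unique hm hm' e
  exact hx

theorem erase_encodeMatrix {Z : Type} (X : ℕ → ℕ → Set Z) (x : Z) :
    (fun i => (encodeMatrix X x i).erase) = alpha := by
  funext i
  rcases exists_row i with ⟨k, rfl⟩ | ⟨k, m, hm, rfl⟩
  · rw [encodeMatrix_rowStart, alpha_rowStart]; rfl
  · rw [encodeMatrix_rowStart_add_succ X x hm, alpha_rowStart_add_succ hm]
    split_ifs <;> rfl

theorem continuous_encodeMatrix {Z : Type} [TopologicalSpace Z] {X : ℕ → ℕ → Set Z}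
    (hX : ∀ m k, IsClopen (X m k)) : Continuous (encodeMatrix X) := by
  classical
  refine continuous_pi fun i => ?_
  rcases exists_row i with ⟨k, rfl⟩ | ⟨k, m, hm, rfl⟩
  · simp only [encodeMatrix_rowStart]
    exact continuous_const
  · simp only [encodeMatrix_rowStart_add_succ X _ hm]
    exact continuous_const.if (fun x hx => by simp [(hX m k).frontier_eq] at hx) continuous_const

theorem fading_encodeMatrix_iff {Z : Type} (X : ℕ → ℕ → Set Z) (x : Z) :
    Fading (encodeMatrix X x) ↔ ∀ m, ∀ᶠ k in atTop, x ∉ X m k := by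
  refine forall_congr' fun m => ⟨fun h => ?_, fun h => ?_⟩
  · filter_upwards [strictMono_rowStart.tendsto_atTop.eventually h, eventually_ge_atTop m]
      with k hk hm hx
    have := hk (encodeMatrix_rowStart X x k)
    rw [encodeMatrix_rowStart_add_succ X x hm, if_pos hx] at this
    cases this
  · obtain ⟨K, hK⟩ := eventually_atTop.1 h
    filter_upwards [eventually_ge_atTop (rowStart (max K m))] with n hn hA
    obtain ⟨k, rfl⟩ := exists_rowStart_of_alpha
      ((eq_A_iff_of_erase (erase_encodeMatrix X x) n).1 hA)
    have hk := strictMono_rowStart.le_iff_le.1 hn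
    rw [encodeMatrix_rowStart_add_succ X x ((le_max_right _ _).trans hk),
      if_neg (hK k ((le_max_left _ _).trans hk))]

theorem IsPi0Complete.of_forall_exists {X : Type} [TopologicalSpace X] {n : ℕ} {F : Set X}
    (hF : IsPi0 n F)
    (h : ∀ (Y : Type) [TopologicalSpace Y] [DiscreteTopology Y] (E : Set (OmegaWord Y)),
      IsPi0 n E → ∃ f : OmegaWord Y → X, Continuous f ∧ E = f ⁻¹' F) :
    IsPi0Complete n F :=
  ⟨hF, fun Y _ _ _ E => ⟨h Y E, fun ⟨_, hf, e⟩ => e ▸ hF.preimage hf⟩⟩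

theorem IsPi0.exists_reduction {Y : Type} [TopologicalSpace Y] [DiscreteTopology Y]
    {E : Set (OmegaWord Y)} (hE : IsPi0 3 E) :
    ∃ f : OmegaWord Y → OmegaWord Letter, Continuous f ∧
      ∀ x, x ∈ E ↔ (f x, alpha) ∈ fadingRelation := by
  obtain ⟨X, hX, hEX⟩ := hE.exists_clopen_matrix
  refine ⟨encodeMatrix X, continuous_encodeMatrix hX, fun x => ?_⟩
  rw [hEX, ← fading_encodeMatrix_iff]
  exact ⟨fun h _ _ => h, fun h => h (erase_encodeMatrix X x) rfl⟩

theorem theorem4p1 :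
    ∃ R : Set (OmegaWord Letter × OmegaWord Letter),
      IsInfinitaryRational R ∧
      IsPi0Complete 3 {σ : OmegaWord Letter | (σ, alpha) ∈ R} ∧
      (∀ u : OmegaWord Letter, u ≠ alpha → {σ : OmegaWord Letter | (σ, u) ∈ R} = Set.univ) ∧
      IsPi0Complete 3 R := by
  refine ⟨fadingRelation, ⟨fadingAutomaton, fadingAutomaton_relation⟩,
    .of_forall_exists (isPi0_fadingRelation.preimage (Continuous.prodMk_left alpha)) ?_,
    fun u hu => eq_univ_of_forall fun σ _ h => absurd h hu,
    .of_forall_exists isPi0_fadingRelation ?_⟩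
  · intro Y _ _ E hE
    obtain ⟨f, hf, h⟩ := hE.exists_reduction
    exact ⟨f, hf, ext h⟩
  · intro Y _ _ E hE
    obtain ⟨f, hf, h⟩ := hE.exists_reduction
    exact ⟨fun x => (f x, alpha), hf.prodMk continuous_const, ext h⟩
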